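/- Let $M$ be a closed 3-manifold with a (finite, simplicial) triangulation $\mathcal T$, with vertex set $V=\{1,\dots,N\}$ and set of tetrahedra $\mathcal T_3$. For $r\in\mathbb R^N_{>0}$ and a tetrahedron $\{ijkl\}\in\mathcal T_3$ put $$Q_{ijkl}=\Big(\tfrac1{r_i}+\tfrac1{r_j}+\tfrac1{r_k}+\tfrac1{r_l}\Big)^2-2\Big(\tfrac1{r_i^2}+\tfrac1{r_j^2}+\tfrac1{r_k^2}+\tfrac1{r_l^2}\Big).$$ The vector $r$ is called a real packing if $Q_{ijkl}>0$ for every $\{ijkl\}\in\mathcal T_3$, and a virtual packing otherwise. The extended solid angle $\tilde\alpha_{ijkl}(r)$ of $\{ijkl\}$ at the vertex $i$ is: if $Q_{ijkl}>0$, the solid angle at $i$ of the Euclidean tetrahedron with edge lengths $l_{pq}=r_p+r_q$ ($p\ne q$ in $\{i,j,k,l\}$); if $Q_{ijkl}\le 0$, it is $2\pi$ when $$\frac1{r_i}\ge\frac1{r_j}+\frac1{r_k}+\frac1{r_l}+2\sqrt{\frac1{r_jr_k}+\frac1{r_jr_l}+\frac1{r_kr_l}}$$ (the ball at $i$ goes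 through the gap between the other three mutually tangent balls) and $0$ otherwise. The extended curvature at $i\in V$ is $\widetilde K_i(r)=4\pi-\sum\tilde\alpha_{ijkl}(r)$, the sum being over all tetrahedra $\{ijkl\}\in\mathcal T_3$ having $i$ as a vertex, and $\tilde\lambda(r)=\sum_{i=1}^N\widetilde K_i(r)r_i\big/\sum_{i=1}^Nr_i$. Let $r:[0,\infty)\to\mathbb R^N_{>0}$ be a solution of the extended flow $$r_i'(t)=\big(\tilde\lambda(r(t))-\widetilde K_i(r(t))\big)\,r_i(t),\qquad i\in V,\ t\ge 0,$$ and suppose that $r(t)$ converges to some $r_\infty\in\mathbb R^N_{>0}$ as $t\to+\infty$. Then $r_\infty$ is a real or virtual packing with constant extended curvature: $\widetilde K_i(r_\infty)$ is the same number for all $i\in V$. -/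

import Mathlib

open Set Filter Topology MeasureTheory

namespace BallPacking

/-! ### Triangulated manifolds -/

/-- The geometric realization of a finite abstract simplicial complex, in barycentric coordinates:
the points of the standard simplex whose support lies in a face. -/
def realization {V : Type*} [Fintype V] (K : AbstractSimplicialComplex V) : Set (V → ℝ) :=
  {x | (∀ v, 0 ≤ x v) ∧ ∑ v, x v = 1 ∧ ∃ σ ∈ K.faces, ∀ v, x v ≠ 0 → v ∈ σ}

/-- A (finite) triangulation of the topological space `M` with vertex set `V`. -/
structure Triangulation (V : Type*) [Fintype V] (M : Type*) [TopologicalSpace M] where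
  /-- the combinatorial structure: vertices, edges, triangles, tetrahedra -/
  complex : AbstractSimplicialComplex V
  /-- the identification of the realization with `M` -/
  homeo : realization complex ≃ₜ M

open Classical in
/-- The set of tetrahedra of a triangulation, each given by its four vertices. -/
noncomputable def Triangulation.tetrahedra {V : Type*} [Fintype V] {M : Type*}
    [TopologicalSpace M] (T : Triangulation V M) : Finset (Finset V) :=
  Finset.univ.filter fun σ => σ ∈ T.complex.faces ∧ σ.card = 4

/-! ### Conformal tetrahedra and solid angles -/

/-- Euclidean three-space. -/
abbrev E3 : Type := EuclideanSpace ℝ (Fin 3)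

/-- `Q_σ = (∑ 1 / r_j)² - 2 ∑ 1 / r_j²`, the sums running over the vertices `j` of `σ`. -/
noncomputable def Q {V : Type*} (r : V → ℝ) (σ : Finset V) : ℝ :=
  (∑ j ∈ σ, 1 / r j) ^ 2 - 2 * ∑ j ∈ σ, 1 / r j ^ 2

/-- The points `p j`, `j ∈ σ`, are the centres of mutually externally tangent balls of radii `r j`:
the edge `{jk}` has length `r_j + r_k`. -/
def IsConformal {V : Type*} (r : V → ℝ) (σ : Finset V) (p : V → E3) : Prop :=
  ∀ j ∈ σ, ∀ k ∈ σ, j ≠ k → dist (p j) (p k) = r j + r k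

theorem exists_four_points {a b c d : ℝ} (ha : 0 < a) (hb : 0 < b) (hc : 0 < c) (hd : 0 < d)
    (hQ : 0 < (1 / a + (1 / b + (1 / c + 1 / d))) ^ 2
      - 2 * (1 / a ^ 2 + (1 / b ^ 2 + (1 / c ^ 2 + 1 / d ^ 2)))) :
    ∃ p q s t : E3, dist p q = a + b ∧ dist p s = a + c ∧ dist p t = a + d ∧
      dist q s = b + c ∧ dist q t = b + d ∧ dist s t = c + d := by
  set A := (1 / a + (1 / b + (1 / c + 1 / d))) ^ 2
      - 2 * (1 / a ^ 2 + (1 / b ^ 2 + (1 / c ^ 2 + 1 / d ^ 2))) with hA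
  obtain ⟨y, hy0, hy⟩ : ∃ y : ℝ, 0 < y ∧ y ^ 2 = 4 * a * b * c * (a + b + c) / (a + b) ^ 2 :=
    ⟨_, Real.sqrt_pos.2 (by positivity), Real.sq_sqrt (by positivity)⟩
  obtain ⟨z, hz⟩ : ∃ z : ℝ, z ^ 2 = a * b * c * d ^ 2 * A / (a + b + c) :=
    ⟨_, Real.sq_sqrt (by positivity)⟩
  set x := ((a + b) ^ 2 + (a + c) ^ 2 - (b + c) ^ 2) / (2 * (a + b)) with hx
  set x' := ((a + b) ^ 2 + (a + d) ^ 2 - (b + d) ^ 2) / (2 * (a + b)) with hx'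
  set w := ((a + d) ^ 2 + (a + c) ^ 2 - (c + d) ^ 2) / 2 - x * x' with hw
  have h1 : x ^ 2 + y ^ 2 = (a + c) ^ 2 := by
    rw [hy, hx]; field_simp; ring
  have h2 : (a + b - x) ^ 2 + y ^ 2 = (b + c) ^ 2 := by
    rw [hy, hx]; field_simp; ring
  have h3 : x' ^ 2 + (w / y) ^ 2 + z ^ 2 = (a + d) ^ 2 := by
    rw [div_pow w, hy, hz, hw, hx, hx', hA]; field_simp; ring
  have h4 : (a + b - x') ^ 2 + (w / y) ^ 2 + z ^ 2 = (b + d) ^ 2 := by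
    have : (a + b - x') ^ 2 = x' ^ 2 + (b + d) ^ 2 - (a + d) ^ 2 := by
      rw [hx']; field_simp; ring
    linarith
  have h5 : (x - x') ^ 2 + (y - w / y) ^ 2 + z ^ 2 = (c + d) ^ 2 := by
    have h6 : y * (w / y) = w := by field_simp
    linear_combination h1 + h3 - 2 * h6 - 2 * hw
  clear_value x x' w
  generalize w / y = v at h3 h4 h5
  have key : ∀ x1 y1 z1 x2 y2 z2 l : ℝ, 0 < l →
      (x1 - x2) ^ 2 + (y1 - y2) ^ 2 + (z1 - z2) ^ 2 = l ^ 2 →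
      dist (!₂[x1, y1, z1] : E3) !₂[x2, y2, z2] = l := by
    intro x1 y1 z1 x2 y2 z2 l hl h
    rw [EuclideanSpace.dist_eq, Real.sqrt_eq_iff_eq_sq (by positivity) hl.le, ← h]
    simp [Fin.sum_univ_three, Real.dist_eq, sq_abs]
  refine ⟨!₂[0, 0, 0], !₂[a + b, 0, 0], !₂[x, y, 0], !₂[x', v, z],
    key _ _ _ _ _ _ _ (by positivity) ?_, key _ _ _ _ _ _ _ (by positivity) ?_,
    key _ _ _ _ _ _ _ (by positivity) ?_, key _ _ _ _ _ _ _ (by positivity) ?_,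
    key _ _ _ _ _ _ _ (by positivity) ?_, key _ _ _ _ _ _ _ (by positivity) ?_⟩
  · ring
  · linear_combination h1
  · linear_combination h3
  · linear_combination h2
  · linear_combination h4
  · linear_combination h5

/-- Four balls with `Q > 0` are realized by a tetrahedron in Euclidean three-space. -/
theorem exists_isConformal {V : Type*} [DecidableEq V] {r : V → ℝ} {σ : Finset V}
    (hcard : σ.card = 4) (hr : ∀ j ∈ σ, 0 < r j) (hQ : 0 < Q r σ) :
    ∃ p : V → E3, IsConformal r σ p := by
  obtain ⟨a, τ, ha, rfl, hτ⟩ := Finset.card_eq_succ.1 hcard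
  obtain ⟨b, c, d, hbc, hbd, hcd, rfl⟩ := Finset.card_eq_three.1 hτ
  simp only [Finset.mem_insert, Finset.mem_singleton, not_or] at ha
  obtain ⟨hab, hac, had⟩ := ha
  simp only [Q] at hQ
  simp only [Finset.mem_insert, Finset.mem_singleton, forall_eq_or_imp, forall_eq] at hr
  have hb' : b ∉ ({c, d} : Finset V) := by simp [hbc, hbd]
  have ha' : a ∉ ({b, c, d} : Finset V) := by simp [hab, hac, had]
  simp only [Finset.sum_insert ha', Finset.sum_insert hb', Finset.sum_pair hcd] at hQ
  obtain ⟨p, q, s, t, h1, h2, h3, h4, h5, h6⟩ :=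
    exists_four_points hr.1 hr.2.1 hr.2.2.1 hr.2.2.2 hQ
  refine ⟨fun v => if v = a then p else if v = b then q else if v = c then s else t, ?_⟩
  intro j hj k hk hjk
  simp only [Finset.mem_insert, Finset.mem_singleton] at hj hk
  have e1 := dist_comm p q
  have e2 := dist_comm p s
  have e3 := dist_comm p t
  have e4 := dist_comm q s
  have e5 := dist_comm q t
  have e6 := dist_comm s t
  have hba := Ne.symm hab
  have hca := Ne.symm hac
  have hda := Ne.symm had
  have hcb := Ne.symm hbc
  have hdb := Ne.symm hbd
  have hdc := Ne.symm hcd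
  rcases hj with rfl | rfl | rfl | rfl <;> rcases hk with rfl | rfl | rfl | rfl <;>
    simp_all <;> linarith

/-- The solid angle at the vertex `p i` of the tetrahedron with vertices `p j`, `j ∈ σ`: the area
of the set of those unit vectors that lie in the cone spanned by the edges issuing from `p i`. -/
noncomputable def solidAngle {V : Type*} [DecidableEq V] (p : V → E3) (σ : Finset V) (i : V) : ℝ :=
  (volume : Measure E3).toSphere.real
    {u : Metric.sphere (0 : E3) 1 | ∃ c : V → ℝ, (∀ j ∈ σ.erase i, 0 ≤ c j) ∧
      (u : E3) = ∑ j ∈ σ.erase i, c j • (p j - p i)}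

open Classical in
/-- Vertices of a Euclidean tetrahedron with edge lengths `r_j + r_k`, if there is one (which is the
case when `Q > 0`, see `exists_isConformal`). It is unique up to an isometry of `E3`. -/
noncomputable def conformalTetrahedron {V : Type*} (r : V → ℝ) (σ : Finset V) : V → E3 :=
  if h : ∃ p : V → E3, IsConformal r σ p then h.choose else 0

theorem isConformal_conformalTetrahedron {V : Type*} [DecidableEq V] {r : V → ℝ} {σ : Finset V}
    (hcard : σ.card = 4) (hr : ∀ j ∈ σ, 0 < r j) (hQ : 0 < Q r σ) :
    IsConformal r σ (conformalTetrahedron r σ) := by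
  have h := exists_isConformal hcard hr hQ
  rw [conformalTetrahedron, dif_pos h]
  exact h.choose_spec

/-- The `i`-th virtual space: the ball at `i` goes through the gap between the three mutually
tangent balls at the other vertices of `σ`, that is
`1/r_i ≥ 1/r_j + 1/r_k + 1/r_l + 2 √(1/(r_j r_k) + 1/(r_j r_l) + 1/(r_k r_l))`. -/
def InVirtualSpace {V : Type*} [DecidableEq V] (r : V → ℝ) (σ : Finset V) (i : V) : Prop :=
  ∑ j ∈ σ.erase i, 1 / r j
    + 2 * √(∑ e ∈ (σ.erase i).powersetCard 2, 1 / ∏ j ∈ e, r j) ≤ 1 / r i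

open Classical in
/-- The extended solid angle of the tetrahedron `σ` at its vertex `i`. -/
noncomputable def extendedSolidAngle {V : Type*} [DecidableEq V] (r : V → ℝ) (σ : Finset V)
    (i : V) : ℝ :=
  if 0 < Q r σ then solidAngle (conformalTetrahedron r σ) σ i
  else if InVirtualSpace r σ i then 2 * Real.pi else 0

/-! ### Packings, extended curvature, extended flow -/

section Packing

variable {V : Type*} [Fintype V] [DecidableEq V] {M : Type*} [TopologicalSpace M]

/-- Real ball packings: positive radii for which every tetrahedron is a Euclidean one. -/
def IsRealPacking (T : Triangulation V M) (r : V → ℝ) : Prop :=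
  (∀ i, 0 < r i) ∧ ∀ σ ∈ T.tetrahedra, 0 < Q r σ

/-- Virtual ball packings: all other assignments of positive radii. -/
def IsVirtualPacking (T : Triangulation V M) (r : V → ℝ) : Prop :=
  (∀ i, 0 < r i) ∧ ¬ IsRealPacking T r

/-- The extended curvature at the vertex `i`: `4π` minus the sum of the extended solid angles at `i`
of the tetrahedra that have `i` as a vertex. -/
noncomputable def extendedCurvature (T : Triangulation V M) (r : V → ℝ) (i : V) : ℝ :=
  4 * Real.pi - ∑ σ ∈ T.tetrahedra with i ∈ σ, extendedSolidAngle r σ i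

/-- The extended Cooper-Rivin-Glickenstein functional (average curvature). -/
noncomputable def extendedCRG (T : Triangulation V M) (r : V → ℝ) : ℝ :=
  (∑ i, extendedCurvature T r i * r i) / ∑ i, r i

/-- `r : [0, ∞) → (0, ∞)^V` solves the extended flow `r_i' = (λ - K_i) r_i` for all `t ≥ 0`
(with a one-sided derivative at `t = 0`). -/
def IsExtendedFlow (T : Triangulation V M) (r : ℝ → V → ℝ) : Prop :=
  (∀ t, 0 ≤ t → ∀ i, 0 < r t i) ∧
  ∀ t, 0 ≤ t → ∀ i, HasDerivWithinAt (fun s => r s i)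
    ((extendedCRG T (r t) - extendedCurvature T (r t) i) * r t i) (Ici 0) t

/-- All vertices have the same extended curvature. -/
def HasConstantExtendedCurvature (T : Triangulation V M) (r : V → ℝ) : Prop :=
  ∃ c : ℝ, ∀ i, extendedCurvature T r i = c

end Packing

end BallPacking

/-! If `K̃_i` is continuous at positive radii, the theorem is soft. Along a convergent solution the
right-hand side of the flow converges to `(λ̃ - K̃_i) r_i` evaluated at the limit. A function
converging together with its derivative has derivative limit `0`
(`eq_zero_of_tendsto_of_tendsto_deriv`), and the limiting radii are nonzero, so every `K̃_i` equals
`λ̃` at the limit.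

The work lies in the continuity of the extended solid angle (`continuousAt_extendedSolidAngle`),
above all across `Q = 0`. For `Q > 0` the angle is three times the volume of the unit ball cut by
the cone at the vertex. In a frame making the edge vectors triangular, the cone is given by three
linear inequalities; multiplied by the determinant, they keep a meaning when the tetrahedron becomes
flat. Dominated convergence gives continuity up to `Q = 0` (`tendsto_volume_coneRegion`). There the
three forms are multiples of one coordinate, so the cone is a half space (angle `2π`) or null (angle
`0`), and Descartes' quadratic form in the inverse radii decides which. On `Q ≤ 0` the prescribed
value `2π` or `0` is locally constant. -/

namespace BallPacking

/-! ### Volumes of cones in triangular coordinates -/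

/-- The points whose coordinates with respect to `(l, 0, 0)`, `(x, y, 0)`, `(x', w, z)`, multiplied
by the determinant `l * y * z`, are nonnegative. -/
def coneRegion (l x y x' w z : ℝ) : Set E3 :=
  {X | 0 ≤ y * z * X 0 - x * z * X 1 + (x * w - y * x') * X 2 ∧
    0 ≤ l * z * X 1 - l * w * X 2 ∧ 0 ≤ l * y * X 2}

theorem isClosed_coneRegion (l x y x' w z : ℝ) : IsClosed (coneRegion l x y x' w z) := by
  have h1 : IsClosed {X : E3 | 0 ≤ y * z * X 0 - x * z * X 1 + (x * w - y * x') * X 2} :=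
    isClosed_le (by fun_prop) (by fun_prop)
  have h2 : IsClosed {X : E3 | 0 ≤ l * z * X 1 - l * w * X 2} :=
    isClosed_le (by fun_prop) (by fun_prop)
  have h3 : IsClosed {X : E3 | 0 ≤ l * y * X 2} := isClosed_le (by fun_prop) (by fun_prop)
  exact h1.inter (h2.inter h3)

/-- The zero set of a nonzero linear form is null. -/
theorem volume_linear_zero {a b c : ℝ} (h : a ≠ 0 ∨ b ≠ 0 ∨ c ≠ 0) :
    volume {X : E3 | a * X 0 + b * X 1 + c * X 2 = 0} = 0 := by
  let f : E3 →ₗ[ℝ] ℝ := (innerSL ℝ (!₂[a, b, c] : E3)).toLinearMap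
  have hf : ∀ X : E3, f X = a * X 0 + b * X 1 + c * X 2 := by
    intro X
    simp [f, PiLp.inner_apply, Fin.sum_univ_three]
    ring
  have : {X : E3 | a * X 0 + b * X 1 + c * X 2 = 0} = (LinearMap.ker f : Set E3) := by
    ext X; simp [hf]
  rw [this]
  apply Measure.addHaar_submodule
  intro htop
  rw [LinearMap.ker_eq_top] at htop
  have h0 := hf !₂[a, b, c]
  rw [htop] at h0
  simp at h0
  rcases h with h | h | h <;>
    nlinarith [mul_self_pos.2 h, mul_self_nonneg a, mul_self_nonneg b, mul_self_nonneg c]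

theorem volume_ball_real : volume.real (Metric.ball (0 : E3) 1) = 4 * Real.pi / 3 := by
  rw [measureReal_def, EuclideanSpace.volume_ball_fin_three]
  rw [ENNReal.toReal_mul, ENNReal.toReal_ofReal (by positivity)]
  simp only [ENNReal.ofReal_one, one_pow, ENNReal.toReal_one]
  ring

/-- The antipodal map exchanges the two halves of the ball up to the null plane `X 2 = 0`. -/
theorem volume_half_ball :
    volume.real (Metric.ball (0 : E3) 1 ∩ {X | 0 ≤ X 2}) = 2 * Real.pi / 3 := by
  set B := Metric.ball (0 : E3) 1 with hB
  set H : Set E3 := {X | 0 ≤ X 2}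
  have hH : MeasurableSet H := (isClosed_le (by fun_prop) (by fun_prop)).measurableSet
  have h1 : volume.real (B ∩ H) + volume.real (B \ H) = volume.real B :=
    measureReal_inter_add_sdiff hH measure_ball_lt_top.ne
  have h2 : volume.real (B \ H) = volume.real (B ∩ H) := by
    have hn : volume (-(B ∩ H)) = volume (B ∩ H) := Measure.measure_neg volume _
    rw [measureReal_def, measureReal_def, ← hn]
    congr 1
    apply measure_congr
    have h0 : ∀ᵐ X : E3, X 2 ≠ 0 := by
      have := volume_linear_zero (a := 0) (b := 0) (c := 1) (by simp)
      rw [ae_iff]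
      simpa using this
    filter_upwards [h0] with X hX
    apply propext
    change (X ∈ B ∧ ¬ (0 ≤ X 2)) ↔ (-X ∈ B ∧ 0 ≤ (-X) 2)
    simp only [hB, Metric.mem_ball, dist_zero_right, norm_neg, PiLp.neg_apply, Left.nonneg_neg_iff,
      not_le]
    exact and_congr_right fun _ => ⟨le_of_lt, fun h => lt_of_le_of_ne h hX⟩
  have h3 := volume_ball_real
  linarith

theorem eventually_nonneg_iff {ι : Type*} {l : Filter ι} {f : ι → ℝ} {c : ℝ}
    (hf : Tendsto f l (𝓝 c)) (hc : c ≠ 0) : ∀ᶠ i in l, (0 ≤ f i ↔ 0 ≤ c) := by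
  rcases lt_or_gt_of_ne hc with h | h
  · filter_upwards [hf.eventually_lt_const h] with i hi
    exact ⟨fun h' => absurd hi h'.not_gt, fun h' => absurd h h'.not_gt⟩
  · filter_upwards [hf.eventually_const_lt h] with i hi
    exact ⟨fun _ => h.le, fun _ => hi.le⟩

/-- Indicators converge off the zero sets of the three limiting linear forms, and the ball
dominates. `h1` and `h2` keep the first two forms nonzero in the flat case `z₀ = 0`, so that these
zero sets are null. -/
theorem tendsto_volume_coneRegion {ι : Type*} {u : Filter ι} [u.IsCountablyGenerated]
    {l x y x' w z : ι → ℝ} {l₀ x₀ y₀ x'₀ w₀ z₀ : ℝ} (hl : Tendsto l u (𝓝 l₀))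
    (hx : Tendsto x u (𝓝 x₀)) (hy : Tendsto y u (𝓝 y₀)) (hx' : Tendsto x' u (𝓝 x'₀))
    (hw : Tendsto w u (𝓝 w₀)) (hz : Tendsto z u (𝓝 z₀)) (hl₀ : l₀ ≠ 0) (hy₀ : y₀ ≠ 0)
    (h1 : z₀ = 0 → x₀ * w₀ - y₀ * x'₀ ≠ 0) (h2 : z₀ = 0 → w₀ ≠ 0) :
    Tendsto (fun i => volume.real
      (Metric.ball 0 1 ∩ coneRegion (l i) (x i) (y i) (x' i) (w i) (z i))) u
      (𝓝 (volume.real (Metric.ball 0 1 ∩ coneRegion l₀ x₀ y₀ x'₀ w₀ z₀))) := by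
  have hfin : volume (Metric.ball (0 : E3) 1 ∩ coneRegion l₀ x₀ y₀ x'₀ w₀ z₀) ≠ ⊤ :=
    ((measure_mono inter_subset_left).trans_lt measure_ball_lt_top).ne
  refine (ENNReal.tendsto_toReal hfin).comp ?_
  refine tendsto_measure_of_ae_tendsto_indicator u
    (measurableSet_ball.inter (isClosed_coneRegion ..).measurableSet)
    (fun i => measurableSet_ball.inter (isClosed_coneRegion ..).measurableSet)
    (measurableSet_ball (x := (0 : E3)) (ε := 1)) measure_ball_lt_top.ne
    (Eventually.of_forall fun i => inter_subset_left) ?_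
  have n1 : ∀ᵐ X : E3, y₀ * z₀ * X 0 + (-(x₀ * z₀)) * X 1 + (x₀ * w₀ - y₀ * x'₀) * X 2 ≠ 0 := by
    rw [ae_iff]
    simp only [not_not]
    apply volume_linear_zero
    by_cases hz0 : z₀ = 0
    · exact Or.inr (Or.inr (h1 hz0))
    · exact Or.inl (mul_ne_zero hy₀ hz0)
  have n2 : ∀ᵐ X : E3, 0 * X 0 + l₀ * z₀ * X 1 + (-(l₀ * w₀)) * X 2 ≠ 0 := by
    rw [ae_iff]
    simp only [not_not]
    apply volume_linear_zero
    by_cases hz0 : z₀ = 0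
    · exact Or.inr (Or.inr (neg_ne_zero.2 (mul_ne_zero hl₀ (h2 hz0))))
    · exact Or.inr (Or.inl (mul_ne_zero hl₀ hz0))
  have n3 : ∀ᵐ X : E3, 0 * X 0 + 0 * X 1 + l₀ * y₀ * X 2 ≠ 0 := by
    rw [ae_iff]
    simp only [not_not]
    apply volume_linear_zero
    exact Or.inr (Or.inr (mul_ne_zero hl₀ hy₀))
  filter_upwards [n1, n2, n3] with X m1 m2 m3
  have e1 := eventually_nonneg_iff
    (f := fun i => y i * z i * X 0 - x i * z i * X 1 + (x i * w i - y i * x' i) * X 2)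
    ((((hy.mul hz).mul_const _).sub ((hx.mul hz).mul_const _)).add
      (((hx.mul hw).sub (hy.mul hx')).mul_const _)) (fun h => m1 (by linear_combination h))
  have e2 := eventually_nonneg_iff
    (f := fun i => l i * z i * X 1 - l i * w i * X 2)
    (((hl.mul hz).mul_const _).sub ((hl.mul hw).mul_const _))
    (fun h => m2 (by linear_combination h))
  have e3 := eventually_nonneg_iff (f := fun i => l i * y i * X 2)
    ((hl.mul hy).mul_const _) (fun h => m3 (by linear_combination h))
  filter_upwards [e1, e2, e3] with i i1 i2 i3
  exact and_congr_right fun _ => and_congr i1 (and_congr i2 i3)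

/-- A flat cone containing its vertex in the interior is a half space. -/
theorem volume_coneRegion_of_pos {l x y x' w : ℝ} (hl : 0 < l) (hy : 0 < y) (hw : w < 0)
    (h : 0 < x * w - y * x') :
    volume.real (Metric.ball 0 1 ∩ coneRegion l x y x' w 0) = 2 * Real.pi / 3 := by
  rw [← volume_half_ball]
  congr 2
  ext X
  simp only [coneRegion, mem_ofPred_eq, mul_zero, zero_mul, sub_self, zero_add, zero_sub]
  rw [mul_nonneg_iff_of_pos_left h, mul_nonneg_iff_of_pos_left (mul_pos hl hy)]
  refine ⟨fun h' => h'.1, fun h' => ⟨h', ?_, h'⟩⟩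
  have := mul_nonneg (mul_pos hl (neg_pos.2 hw)).le h'
  linarith

/-- With `z = 0` all three forms are multiples of `X 2`. The third forces `X 2 ≥ 0` and one of the
others `X 2 ≤ 0`, leaving only a plane. -/
theorem volume_coneRegion_of_neg {l x y x' w : ℝ} (hl : 0 < l) (hy : 0 < y)
    (h : 0 < w ∨ x * w - y * x' < 0) :
    volume.real (Metric.ball 0 1 ∩ coneRegion l x y x' w 0) = 0 := by
  rw [measureReal_def]
  suffices volume (Metric.ball 0 1 ∩ coneRegion l x y x' w 0) = 0 by rw [this]; rfl
  refine measure_mono_null ?_ (volume_linear_zero (a := 0) (b := 0) (c := 1) (by simp))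
  rintro X ⟨-, h1, h2, h3⟩
  simp only [mem_ofPred_eq, mul_zero, zero_mul, sub_self, zero_add, zero_sub, one_mul] at *
  have h3' := (mul_nonneg_iff_of_pos_left (mul_pos hl hy)).1 h3
  refine le_antisymm ?_ h3'
  by_contra! hX
  rcases h with h | h
  · have := mul_pos (mul_pos hl h) hX
    linarith
  · have := mul_neg_of_neg_of_pos h hX
    linarith

/-! ### Solid angle as the volume of a cone -/

open scoped Pointwise in
/-- The solid angle of a tetrahedron in terms of the coordinates of its edge vectors in an adapted
orthonormal frame. -/
theorem solidAngle_eq_volume_coneRegion {V : Type*} [DecidableEq V] {p : V → E3} {σ : Finset V}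
    {i b c d : V} (hσ : σ.erase i = {b, c, d}) (hbc : b ≠ c) (hbd : b ≠ d) (hcd : c ≠ d)
    {l x y x' w z : ℝ} (hl : 0 < l) (hy : 0 < y) (hz : 0 < z)
    (gbb : inner ℝ (p b - p i) (p b - p i) = l ^ 2)
    (gbc : inner ℝ (p b - p i) (p c - p i) = l * x)
    (gbd : inner ℝ (p b - p i) (p d - p i) = l * x')
    (gcc : inner ℝ (p c - p i) (p c - p i) = x ^ 2 + y ^ 2)
    (gcd : inner ℝ (p c - p i) (p d - p i) = x * x' + y * w)
    (gdd : inner ℝ (p d - p i) (p d - p i) = x' ^ 2 + w ^ 2 + z ^ 2) :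
    solidAngle p σ i = 3 * volume.real (Metric.ball 0 1 ∩ coneRegion l x y x' w z) := by
  set vb := p b - p i with hvb
  set vc := p c - p i with hvc
  set vd := p d - p i with hvd
  have gcb : inner ℝ vc vb = l * x := by rw [real_inner_comm, gbc]
  have gdb : inner ℝ vd vb = l * x' := by rw [real_inner_comm, gbd]
  have gdc : inner ℝ vd vc = x * x' + y * w := by rw [real_inner_comm, gcd]
  let e : Fin 3 → E3 →ₗ[ℝ] ℝ := fun k => (EuclideanSpace.proj k : E3 →L[ℝ] ℝ).toLinearMap
  have he : ∀ k X, e k X = X k := fun k X => rfl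
  -- Back substitution: `α`, `β`, `γ` are the coordinates with respect to the triangular basis `(l,
  -- 0, 0)`, `(x, y, 0)`, `(x', w, z)`.
  let γ : E3 →ₗ[ℝ] ℝ := z⁻¹ • e 2
  let β : E3 →ₗ[ℝ] ℝ := y⁻¹ • (e 1 - w • γ)
  let α : E3 →ₗ[ℝ] ℝ := l⁻¹ • (e 0 - x • β - x' • γ)
  have hγ : ∀ X : E3, X 2 = z * γ X := by
    intro X
    simp only [γ, LinearMap.smul_apply, he, smul_eq_mul]
    field_simp
  have hβ : ∀ X : E3, X 1 = y * β X + w * γ X := by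
    intro X
    simp only [β, LinearMap.smul_apply, LinearMap.sub_apply, he, smul_eq_mul]
    field_simp
    ring
  have hα : ∀ X : E3, X 0 = l * α X + x * β X + x' * γ X := by
    intro X
    simp only [α, LinearMap.smul_apply, LinearMap.sub_apply, he, smul_eq_mul]
    field_simp
    ring
  let Φ₀ : E3 →ₗ[ℝ] E3 := α.smulRight vb + β.smulRight vc + γ.smulRight vd
  have hΦ₀ : ∀ X, Φ₀ X = α X • vb + β X • vc + γ X • vd := fun X => rfl
  -- `Φ₀` carries the triangular basis to the edge vectors; both have the same Gram matrix, so it is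
  -- an isometry.
  have hnorm : ∀ X, ‖Φ₀ X‖ = ‖X‖ := by
    intro X
    have h1 : ‖Φ₀ X‖ ^ 2 = ‖X‖ ^ 2 := by
      rw [EuclideanSpace.norm_sq_eq X, Fin.sum_univ_three, ← real_inner_self_eq_norm_sq, hΦ₀]
      simp only [inner_add_left, inner_add_right, real_inner_smul_left, real_inner_smul_right,
        gbb, gbc, gbd, gcb, gcc, gcd, gdb, gdc, gdd, Real.norm_eq_abs, sq_abs]
      rw [hα, hβ, hγ]
      ring
    exact (sq_eq_sq₀ (norm_nonneg _) (norm_nonneg _)).1 h1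
  let Φ : E3 ≃ₗᵢ[ℝ] E3 :=
    LinearIsometry.toLinearIsometryEquiv ⟨Φ₀, hnorm⟩ rfl
  have hΦ : ∀ X, Φ X = α X • vb + β X • vc + γ X • vd := fun X => rfl
  have hmem : ∀ X, X ∈ coneRegion l x y x' w z ↔ 0 ≤ α X ∧ 0 ≤ β X ∧ 0 ≤ γ X := by
    intro X
    have h1 : y * z * X 0 - x * z * X 1 + (x * w - y * x') * X 2 = (l * y * z) * α X := by
      rw [hα, hβ, hγ]; ring
    have h2 : l * z * X 1 - l * w * X 2 = (l * y * z) * β X := by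
      rw [hβ, hγ]; ring
    have h3 : l * y * X 2 = (l * y * z) * γ X := by
      rw [hγ]; ring
    have h4 : 0 < l * y * z := by positivity
    simp only [coneRegion, mem_ofPred_eq]
    rw [h1, h2, h3, mul_nonneg_iff_of_pos_left h4, mul_nonneg_iff_of_pos_left h4,
      mul_nonneg_iff_of_pos_left h4]
  have hcoord : ∀ X Y : E3, α X = α Y → β X = β Y → γ X = γ Y → X = Y := by
    intro X Y h1 h2 h3
    ext k
    fin_cases k
    · change X 0 = Y 0
      rw [hα, hα Y, h1, h2, h3]
    · change X 1 = Y 1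
      rw [hβ, hβ Y, h2, h3]
    · change X 2 = Y 2
      rw [hγ, hγ Y, h3]
  have hinv : ∀ s t q : ℝ, ∃ X, α X = s ∧ β X = t ∧ γ X = q := by
    intro s t q
    refine ⟨!₂[l * s + x * t + x' * q, y * t + w * q, z * q], ?_⟩
    set X : E3 := !₂[l * s + x * t + x' * q, y * t + w * q, z * q] with hX
    have h1 := hα X
    have h2 := hβ X
    have h3 := hγ X
    simp only [hX, PiLp.toLp_apply, Matrix.cons_val_zero, Matrix.cons_val_one,
      Matrix.cons_val] at h1 h2 h3
    rw [← hX] at h1 h2 h3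
    have h3' : γ X = q := (mul_left_cancel₀ hz.ne' h3).symm
    rw [h3'] at h1 h2
    have h2' : β X = t := (mul_left_cancel₀ hy.ne' (add_right_cancel h2)).symm
    rw [h2'] at h1
    exact ⟨(mul_left_cancel₀ hl.ne' (by linarith)), h2', h3'⟩
  have hcone : ∀ Y : E3, (∃ k : V → ℝ, (∀ j ∈ σ.erase i, 0 ≤ k j) ∧
      Y = ∑ j ∈ σ.erase i, k j • (p j - p i)) ↔ Φ.symm Y ∈ coneRegion l x y x' w z := by
    intro Y
    have hb : b ∉ ({c, d} : Finset V) := by simp [hbc, hbd]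
    rw [hσ, hmem]
    simp only [Finset.sum_insert hb, Finset.sum_pair hcd, Finset.mem_insert, Finset.mem_singleton,
      forall_eq_or_imp, forall_eq]
    rw [← hvb, ← hvc, ← hvd]
    constructor
    · rintro ⟨k, ⟨kb, kc, kd⟩, hY⟩
      obtain ⟨X, h1, h2, h3⟩ := hinv (k b) (k c) (k d)
      have : Φ.symm Y = X := by
        rw [LinearIsometryEquiv.symm_apply_eq, hΦ, h1, h2, h3, hY, add_assoc]
      rw [this, h1, h2, h3]
      exact ⟨kb, kc, kd⟩
    · rintro ⟨h1, h2, h3⟩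
      refine ⟨fun v => if v = b then α (Φ.symm Y) else if v = c then β (Φ.symm Y) else
        γ (Φ.symm Y), ?_, ?_⟩
      · simp [hbc.symm, hbd.symm, hcd.symm, h1, h2, h3]
      · simp only [if_true, hbc.symm, hbd.symm, hcd.symm, if_false]
        rw [← add_assoc, ← hΦ, LinearIsometryEquiv.apply_symm_apply]
  have hscale : ∀ (t : ℝ) (X : E3), 0 < t → X ∈ coneRegion l x y x' w z →
      t • X ∈ coneRegion l x y x' w z := by
    intro t X ht hX
    rw [hmem] at hX ⊢
    simp only [map_smul, smul_eq_mul]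
    exact ⟨mul_nonneg ht.le hX.1, mul_nonneg ht.le hX.2.1, mul_nonneg ht.le hX.2.2⟩
  have hclosed := isClosed_coneRegion l x y x' w z
  set C := coneRegion l x y x' w z
  unfold solidAngle
  set S : Set (Metric.sphere (0 : E3) 1) := {u | ∃ k : V → ℝ, (∀ j ∈ σ.erase i, 0 ≤ k j) ∧
      (u : E3) = ∑ j ∈ σ.erase i, k j • (p j - p i)} with hS
  have hSmem : ∀ u, u ∈ S ↔ Φ.symm (u : E3) ∈ C := fun u => hcone u
  have hSm : MeasurableSet S := by
    have : S = (fun u : Metric.sphere (0 : E3) 1 => Φ.symm (u : E3)) ⁻¹' C := by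
      ext u; exact hSmem u
    rw [this]
    exact (hclosed.preimage (Φ.symm.continuous.comp continuous_subtype_val)).measurableSet
  -- `toSphere` measures `S` as the dimension, `3`, times the volume of the cone over `S` with radii
  -- in `(0, 1)`; the missing apex is null.
  have hset : Ioo (0 : ℝ) 1 • ((↑) '' S : Set E3) = Φ.symm ⁻¹' (Metric.ball 0 1 ∩ C) \ {0} := by
    ext Y
    constructor
    · rintro ⟨t, ht, _, ⟨u, hu, rfl⟩, rfl⟩
      have hu1 : ‖(u : E3)‖ = 1 := by simp
      refine ⟨⟨?_, ?_⟩, ?_⟩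
      · simp only [Metric.mem_ball, dist_zero_right, LinearIsometryEquiv.norm_map, norm_smul, hu1,
          mul_one, Real.norm_eq_abs, abs_of_pos ht.1]
        exact ht.2
      · change Φ.symm (t • (u : E3)) ∈ C
        rw [map_smul]
        exact hscale _ _ ht.1 ((hSmem u).1 hu)
      · intro h0
        have : ‖t • (u : E3)‖ = 0 := by
          rw [show t • (u : E3) = 0 from h0, norm_zero]
        rw [norm_smul, hu1, mul_one, norm_eq_zero] at this
        exact ht.1.ne' this
    · rintro ⟨⟨h1, h2⟩, h3⟩
      have hY : 0 < ‖Y‖ := norm_pos_iff.2 h3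
      simp only [Metric.mem_ball, dist_zero_right, LinearIsometryEquiv.norm_map] at h1
      refine ⟨‖Y‖, ⟨hY, h1⟩, ‖Y‖⁻¹ • Y, ⟨⟨‖Y‖⁻¹ • Y, ?_⟩, ?_, rfl⟩, ?_⟩
      · simp [norm_smul, hY.ne']
      · rw [hSmem]
        change Φ.symm (‖Y‖⁻¹ • Y) ∈ C
        rw [map_smul]
        exact hscale _ _ (inv_pos.2 hY) h2
      · change ‖Y‖ • ‖Y‖⁻¹ • Y = Y
        rw [smul_smul, mul_inv_cancel₀ hY.ne', one_smul]
  have hmp : volume (Φ.symm ⁻¹' (Metric.ball 0 1 ∩ C)) = volume (Metric.ball 0 1 ∩ C) :=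
    Φ.symm.measurePreserving.measure_preimage
      (measurableSet_ball.inter hclosed.measurableSet).nullMeasurableSet
  rw [measureReal_def, Measure.toSphere_apply' _ hSm, hset,
    measure_sdiff_null (measure_singleton _), hmp, ENNReal.toReal_mul]
  simp [measureReal_def]

/-! ### Coordinates of a conformal tetrahedron in terms of the four radii -/

/-- The expression `Q` as a function of four radii. -/
noncomputable def fourQ (a b c d : ℝ) : ℝ :=
  (1 / a + (1 / b + (1 / c + 1 / d))) ^ 2 - 2 * (1 / a ^ 2 + (1 / b ^ 2 + (1 / c ^ 2 + 1 / d ^ 2)))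

/-- Coordinate along the first edge of the second edge vector. -/
noncomputable def edgeX (a b c : ℝ) : ℝ := (a ^ 2 + a * b + a * c - b * c) / (a + b)

/-- Coordinate orthogonal to the first edge of the second edge vector. -/
noncomputable def edgeY (a b c : ℝ) : ℝ := √(4 * a * b * c * (a + b + c)) / (a + b)

/-- Second coordinate of the third edge vector. -/
noncomputable def edgeW (a b c d : ℝ) : ℝ :=
  (a ^ 2 + a * c + a * d - c * d - edgeX a b c * edgeX a b d) / edgeY a b c

/-- Height of the fourth vertex over the face of the other three. -/
noncomputable def edgeZ (a b c d : ℝ) : ℝ := √(a * b * c * d ^ 2 * fourQ a b c d / (a + b + c))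

/-- The cone at the vertex of radius `a`, in adapted coordinates. -/
noncomputable def conformalRegion (a b c d : ℝ) : Set E3 :=
  coneRegion (a + b) (edgeX a b c) (edgeY a b c) (edgeX a b d) (edgeW a b c d) (edgeZ a b c d)

section Radii

variable {a b c d : ℝ} (ha : 0 < a) (hb : 0 < b) (hc : 0 < c) (hd : 0 < d)
include ha hb hc

theorem edgeY_pos : 0 < edgeY a b c := by unfold edgeY; positivity

theorem edgeY_sq : edgeY a b c ^ 2 = 4 * a * b * c * (a + b + c) / (a + b) ^ 2 := by
  rw [edgeY, div_pow, Real.sq_sqrt (by positivity)]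

theorem edgeY_mul_edgeW : edgeY a b c * edgeW a b c d =
    a ^ 2 + a * c + a * d - c * d - edgeX a b c * edgeX a b d :=
  mul_div_cancel₀ _ (edgeY_pos ha hb hc).ne'

theorem edgeX_sq_add_edgeY_sq : edgeX a b c ^ 2 + edgeY a b c ^ 2 = (a + c) ^ 2 := by
  rw [edgeY_sq ha hb hc, edgeX]; field_simp; ring

include hd

theorem edge_normSq (hQ : 0 ≤ fourQ a b c d) :
    edgeX a b d ^ 2 + edgeW a b c d ^ 2 + edgeZ a b c d ^ 2 = (a + d) ^ 2 := by
  rw [edgeZ, Real.sq_sqrt (by positivity), edgeW, div_pow, edgeY_sq ha hb hc]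
  unfold edgeX fourQ
  field_simp
  ring

/-- For arbitrary `Q` the identity has an extra term in `fourQ`. At `Q = 0` what remains is a
difference of squares of inverse radii, whose sign is tractable. -/
theorem edgeW_mul (hQ : fourQ a b c d = 0) : (a + b) ^ 2 * edgeY a b c * edgeW a b c d =
    -(a ^ 2 * b ^ 2 * c * d * ((1 / a + 1 / b) ^ 2 - (1 / c - 1 / d) ^ 2)) := by
  have h : (a + b) ^ 2 * edgeY a b c * edgeW a b c d =
    -(a ^ 2 * b ^ 2 * c * d * ((1 / a + 1 / b) ^ 2 - (1 / c - 1 / d) ^ 2 - fourQ a b c d)) := by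
    rw [mul_assoc, edgeY_mul_edgeW ha hb hc]
    unfold edgeX fourQ
    field_simp
    ring
  rwa [hQ, sub_zero] at h

/-- The counterpart of `edgeW_mul` with the roles of `b` and `c` exchanged. -/
theorem edge_cross_mul (hQ : fourQ a b c d = 0) :
    (a + b) * edgeY a b c * (edgeX a b c * edgeW a b c d - edgeY a b c * edgeX a b d) =
    a ^ 2 * c ^ 2 * b * d * ((1 / a + 1 / c) ^ 2 - (1 / b - 1 / d) ^ 2) := by
  have h : (a + b) * edgeY a b c * (edgeX a b c * edgeW a b c d - edgeY a b c * edgeX a b d) =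
    a ^ 2 * c ^ 2 * b * d * ((1 / a + 1 / c) ^ 2 - (1 / b - 1 / d) ^ 2 - fourQ a b c d) := by
    -- Regrouped so that only `edgeY * edgeW` and `edgeY ^ 2` occur, which are free of square roots.
    have : (a + b) * edgeY a b c * (edgeX a b c * edgeW a b c d - edgeY a b c * edgeX a b d) =
      (a + b) * (edgeX a b c * (edgeY a b c * edgeW a b c d) - edgeY a b c ^ 2 * edgeX a b d) := by
      ring
    rw [this, edgeY_mul_edgeW ha hb hc, edgeY_sq ha hb hc]
    unfold edgeX fourQ
    field_simp
    ring
  rwa [hQ, sub_zero] at h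

end Radii

/-! ### Signs of Descartes' form and flat cones -/

theorem fourQ_eq (a b c d : ℝ) : fourQ a b c d =
    4 * (1 / b * (1 / c) + 1 / b * (1 / d) + 1 / c * (1 / d))
      - (1 / a - (1 / b + 1 / c + 1 / d)) ^ 2 := by
  unfold fourQ
  simp only [one_div]
  ring

/-- If the difference of squares vanished, then `p = k + q + u` or `u = k + p + q`. Substituting
this turns the form into four times the sum of pairwise products of the other three numbers, which
is positive. -/
theorem sq_ne_of_descartes {k p q u : ℝ} (hk : 0 < k) (hp : 0 < p) (hq : 0 < q) (hu : 0 < u)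
    (h : 4 * (p * q + p * u + q * u) - (k - (p + q + u)) ^ 2 = 0) :
    (k + q) ^ 2 - (p - u) ^ 2 ≠ 0 := by
  intro h0
  have e : (k + q - (p - u)) * (k + q + (p - u)) = 0 := by linear_combination h0
  rcases mul_eq_zero.1 e with e | e
  · have : k = p - u - q := by linarith
    subst this
    nlinarith [mul_pos hk hq, mul_pos hk hu, mul_pos hq hu]
  · have : k = u - p - q := by linarith
    subst this
    nlinarith [mul_pos hk hq, mul_pos hk hp, mul_pos hq hp]

/-- Put `s = x + y + z - m ≥ 0`. Maximality of `m` bounds `s` by each sum of two of `x`, `y`, `z`,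
so `s² ≤ (y + z) s ≤ y (x + z) + z (x + y)`. -/
theorem descartes_pos_of_max {m x y z : ℝ} (hx : 0 < x) (hy : 0 < y) (hz : 0 < z) (h1 : x ≤ m)
    (h2 : y ≤ m) (h3 : z ≤ m) (h : m ≤ x + y + z) :
    0 < 4 * (x * y + x * z + y * z) - (m - (x + y + z)) ^ 2 := by
  have e0 : 0 ≤ x + y + z - m := by linarith
  have e1 : (x + y + z - m) * (x + y + z - m) ≤ (y + z) * (x + y + z - m) :=
    mul_le_mul_of_nonneg_right (by linarith) e0
  have e2 : y * (x + y + z - m) ≤ y * (x + z) := mul_le_mul_of_nonneg_left (by linarith) hy.le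
  have e3 : z * (x + y + z - m) ≤ z * (x + y) := mul_le_mul_of_nonneg_left (by linarith) hz.le
  have hxy := mul_pos hx hy
  have hxz := mul_pos hx hz
  have hyz := mul_pos hy hz
  linarith

/-- If both differences were nonnegative, none of the four numbers would exceed the sum of the
others; `descartes_pos_of_max`, applied to the largest, would contradict the vanishing of the form.
-/
theorem descartes_neg {k p q u : ℝ} (hk : 0 < k) (hp : 0 < p) (hq : 0 < q) (hu : 0 < u)
    (h : 4 * (p * q + p * u + q * u) - (k - (p + q + u)) ^ 2 = 0) (hlt : k < p + q + u) :
    (k + p) ^ 2 - (q - u) ^ 2 < 0 ∨ (k + q) ^ 2 - (p - u) ^ 2 < 0 := by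
  by_contra! hcon
  obtain ⟨h1, h2⟩ := hcon
  obtain ⟨h5, h6⟩ := abs_le.1 (abs_le_of_sq_le_sq (sub_nonneg.1 h1) (by linarith))
  obtain ⟨h7, h8⟩ := abs_le.1 (abs_le_of_sq_le_sq (sub_nonneg.1 h2) (by linarith))
  by_cases hk' : p ≤ k ∧ q ≤ k ∧ u ≤ k
  · linarith [descartes_pos_of_max hp hq hu hk'.1 hk'.2.1 hk'.2.2 hlt.le]
  by_cases hp' : k ≤ p ∧ q ≤ p ∧ u ≤ p
  · linarith [descartes_pos_of_max hk hq hu hp'.1 hp'.2.1 hp'.2.2 (by linarith)]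
  by_cases hq' : k ≤ q ∧ p ≤ q ∧ u ≤ q
  · linarith [descartes_pos_of_max hk hp hu hq'.1 hq'.2.1 hq'.2.2 (by linarith)]
  have hu' : k ≤ u ∧ p ≤ u ∧ q ≤ u := by grind
  linarith [descartes_pos_of_max hk hp hq hu'.1 hu'.2.1 hu'.2.2 (by linarith)]

/-- `P` is any predicate invariant under positive scaling, so one proof serves `≠ 0`, `0 <` and `<
0`. -/
theorem edgeW_sign {a b c d : ℝ} (ha : 0 < a) (hb : 0 < b) (hc : 0 < c) (hd : 0 < d)
    (hQ : fourQ a b c d = 0) {P : ℝ → Prop} (hP : ∀ s t, 0 < s → (P (s * t) ↔ P t)) :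
    P (-edgeW a b c d) ↔ P ((1 / a + 1 / b) ^ 2 - (1 / c - 1 / d) ^ 2) := by
  have h := edgeW_mul ha hb hc hd hQ
  have hy := edgeY_pos ha hb hc
  rw [← hP ((a + b) ^ 2 * edgeY a b c) _ (by positivity), mul_neg, h, neg_neg, hP _ _ (by positivity)]

theorem edge_cross_sign {a b c d : ℝ} (ha : 0 < a) (hb : 0 < b) (hc : 0 < c) (hd : 0 < d)
    (hQ : fourQ a b c d = 0) {P : ℝ → Prop} (hP : ∀ s t, 0 < s → (P (s * t) ↔ P t)) :
    P (edgeX a b c * edgeW a b c d - edgeY a b c * edgeX a b d) ↔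
      P ((1 / a + 1 / c) ^ 2 - (1 / b - 1 / d) ^ 2) := by
  have h := edge_cross_mul ha hb hc hd hQ
  have hy := edgeY_pos ha hb hc
  rw [← hP ((a + b) * edgeY a b c) _ (by positivity), h, hP _ _ (by positivity)]

theorem edgeZ_eq_zero {a b c d : ℝ} (hQ : fourQ a b c d = 0) : edgeZ a b c d = 0 := by
  simp [edgeZ, hQ]

section Degenerate

variable {a b c d : ℝ} (ha : 0 < a) (hb : 0 < b) (hc : 0 < c) (hd : 0 < d)
  (hQ : fourQ a b c d = 0)
include ha hb hc hd hQ

theorem edgeW_ne_zero : edgeW a b c d ≠ 0 := by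
  have h := (edgeW_sign ha hb hc hd hQ (P := (· ≠ 0)) (fun s t hs => by simp [hs.ne'])).2
  rw [fourQ_eq] at hQ
  exact neg_ne_zero.1 (h (sq_ne_of_descartes (q := 1 / b) (p := 1 / c) (by positivity)
    (by positivity) (by positivity) (by positivity) (by linear_combination hQ)))

theorem edge_cross_ne_zero :
    edgeX a b c * edgeW a b c d - edgeY a b c * edgeX a b d ≠ 0 := by
  have h := (edge_cross_sign ha hb hc hd hQ (P := (· ≠ 0)) (fun s t hs => by simp [hs.ne'])).2
  rw [fourQ_eq] at hQ
  exact h (sq_ne_of_descartes (by positivity)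
    (by positivity) (by positivity) (by positivity) (by linear_combination hQ))

/-- The inequality gives `1/a + 1/b > |1/c - 1/d|` and `1/a + 1/c > |1/b - 1/d|`. These are the sign
conditions under which the flat cone is a half space. -/
theorem volume_conformalRegion_of_lt (h : 1 / b + 1 / c + 1 / d < 1 / a) :
    3 * volume.real (Metric.ball 0 1 ∩ conformalRegion a b c d) = 2 * Real.pi := by
  have hb' : 0 < 1 / b := by positivity
  have hc' : 0 < 1 / c := by positivity
  have hd' : 0 < 1 / d := by positivity
  have h1 := (edgeW_sign ha hb hc hd hQ (P := (0 < ·))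
    (fun s t hs => mul_pos_iff_of_pos_left hs)).2 (by nlinarith)
  have h2 := (edge_cross_sign ha hb hc hd hQ (P := (0 < ·))
    (fun s t hs => mul_pos_iff_of_pos_left hs)).2 (by nlinarith)
  rw [conformalRegion, edgeZ_eq_zero hQ, volume_coneRegion_of_pos (by positivity)
    (edgeY_pos ha hb hc) (neg_pos.1 h1) h2]
  ring

theorem volume_conformalRegion_of_gt (h : 1 / a < 1 / b + 1 / c + 1 / d) :
    3 * volume.real (Metric.ball 0 1 ∩ conformalRegion a b c d) = 0 := by
  rw [conformalRegion, edgeZ_eq_zero hQ, volume_coneRegion_of_neg (by positivity)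
    (edgeY_pos ha hb hc), mul_zero]
  have hQ' := hQ
  rw [fourQ_eq] at hQ'
  rcases descartes_neg (by positivity) (by positivity) (by positivity) (by positivity) hQ' h
    with h' | h'
  · exact Or.inl (neg_neg_iff_pos.1 ((edgeW_sign ha hb hc hd hQ (P := (· < 0))
      (fun s t hs => by simp [mul_neg_iff, hs, hs.not_gt])).2 h'))
  · exact Or.inr ((edge_cross_sign ha hb hc hd hQ (P := (· < 0))
      (fun s t hs => by simp [mul_neg_iff, hs, hs.not_gt])).2 h')

end Degenerate

/-! ### Continuity of the extended solid angle -/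

section Angle

variable {V : Type*} {i b c d : V}

theorem inner_edge {r : V → ℝ} {σ : Finset V} {p : V → E3} (hp : IsConformal r σ p)
    (hi : i ∈ σ) {j k : V} (hj : j ∈ σ) (hk : k ∈ σ) (hij : i ≠ j) (hik : i ≠ k) (hjk : j ≠ k) :
    inner ℝ (p j - p i) (p k - p i) = r i ^ 2 + r i * r j + r i * r k - r j * r k := by
  have h := real_inner_eq_norm_mul_self_add_norm_mul_self_sub_norm_sub_mul_self_div_two
    (p j - p i) (p k - p i)
  rw [h, sub_sub_sub_cancel_right, ← dist_eq_norm, ← dist_eq_norm, ← dist_eq_norm,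
    hp j hj k hk hjk, hp j hj i hi hij.symm, hp k hk i hi hik.symm]
  ring

theorem inner_edge_self {r : V → ℝ} {σ : Finset V} {p : V → E3} (hp : IsConformal r σ p)
    (hi : i ∈ σ) {j : V} (hj : j ∈ σ) (hij : i ≠ j) :
    inner ℝ (p j - p i) (p j - p i) = (r i + r j) ^ 2 := by
  rw [real_inner_self_eq_norm_sq, ← dist_eq_norm, hp j hj i hi hij.symm, add_comm]

theorem continuousAt_one_div {r₀ : V → ℝ} (hr : ∀ j, 0 < r₀ j) (j : V) :
    ContinuousAt (fun r : V → ℝ => 1 / r j) r₀ :=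
  continuousAt_const.div (continuous_apply j).continuousAt (hr j).ne'

theorem continuousAt_fourQ {r₀ : V → ℝ} (hr : ∀ j, 0 < r₀ j) (i b c d : V) :
    ContinuousAt (fun r : V → ℝ => fourQ (r i) (r b) (r c) (r d)) r₀ := by
  have k := continuousAt_one_div hr
  simp only [fourQ_eq]
  exact (((((k b).mul (k c)).add ((k b).mul (k d))).add ((k c).mul (k d))).const_mul 4).sub
    (((k i).sub (((k b).add (k c)).add (k d))).pow 2)

/-- The limit runs over a full neighbourhood even when `Q = 0` at `r₀`: where `Q < 0`, the real
square root makes `edgeZ` equal to `0`, which keeps it continuous. -/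
theorem tendsto_volume_conformalRegion {r₀ : V → ℝ} (hr : ∀ j, 0 < r₀ j)
    [Finite V] (hQ : 0 ≤ fourQ (r₀ i) (r₀ b) (r₀ c) (r₀ d)) :
    Tendsto (fun r : V → ℝ => 3 * volume.real
      (Metric.ball 0 1 ∩ conformalRegion (r i) (r b) (r c) (r d))) (𝓝 r₀)
      (𝓝 (3 * volume.real
        (Metric.ball 0 1 ∩ conformalRegion (r₀ i) (r₀ b) (r₀ c) (r₀ d)))) := by
  have hi := hr i
  have hb := hr b
  have hc := hr c
  have hd := hr d
  have hy := edgeY_pos hi hb hc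
  have n1 : r₀ i + r₀ b ≠ 0 := by positivity
  have n2 : r₀ i + r₀ b + r₀ c ≠ 0 := by positivity
  have cx : ∀ j, ContinuousAt (fun r : V → ℝ => edgeX (r i) (r b) (r j)) r₀ := by
    intro j
    unfold edgeX
    fun_prop (disch := assumption)
  have cy : ContinuousAt (fun r : V → ℝ => edgeY (r i) (r b) (r c)) r₀ := by
    unfold edgeY
    fun_prop (disch := assumption)
  have cw : ContinuousAt (fun r : V → ℝ => edgeW (r i) (r b) (r c) (r d)) r₀ := by
    have := cx c
    have := cx d
    unfold edgeW
    fun_prop (disch := exact hy.ne')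
  have cQ := continuousAt_fourQ hr i b c d
  have cz : ContinuousAt (fun r : V → ℝ => edgeZ (r i) (r b) (r c) (r d)) r₀ := by
    unfold edgeZ
    fun_prop (disch := assumption)
  have cl : ContinuousAt (fun r : V → ℝ => r i + r b) r₀ := by fun_prop
  have hz : edgeZ (r₀ i) (r₀ b) (r₀ c) (r₀ d) = 0 → fourQ (r₀ i) (r₀ b) (r₀ c) (r₀ d) = 0 := by
    intro hz
    by_contra hne
    have hpos : 0 < fourQ (r₀ i) (r₀ b) (r₀ c) (r₀ d) := lt_of_le_of_ne hQ (Ne.symm hne)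
    have : 0 < edgeZ (r₀ i) (r₀ b) (r₀ c) (r₀ d) := Real.sqrt_pos.2 (by positivity)
    exact this.ne' hz
  exact (tendsto_volume_coneRegion cl (cx c) cy (cx d) cw cz n1 hy.ne'
    (fun h => edge_cross_ne_zero hi hb hc hd (hz h))
    (fun h => edgeW_ne_zero hi hb hc hd (hz h))).const_mul 3

variable [DecidableEq V] (hib : i ≠ b) (hic : i ≠ c) (hid : i ≠ d) (hbc : b ≠ c) (hbd : b ≠ d) (hcd : c ≠ d)
include hib hic hid

theorem erase_four : ({i, b, c, d} : Finset V).erase i = {b, c, d} :=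
  Finset.erase_insert (by simp [hib, hic, hid])

include hbc hbd hcd

theorem Q_four (r : V → ℝ) : Q r {i, b, c, d} = fourQ (r i) (r b) (r c) (r d) := by
  have h1 : b ∉ ({c, d} : Finset V) := by simp [hbc, hbd]
  have h2 : i ∉ ({b, c, d} : Finset V) := by simp [hib, hic, hid]
  simp only [Q, fourQ, Finset.sum_insert h2, Finset.sum_insert h1, Finset.sum_pair hcd]

theorem inVirtualSpace_four (r : V → ℝ) : InVirtualSpace r {i, b, c, d} i ↔
    1 / r b + 1 / r c + 1 / r d + 2 * √(1 / r b * (1 / r c) + 1 / r b * (1 / r d)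
      + 1 / r c * (1 / r d)) ≤ 1 / r i := by
  have h1 : b ∉ ({c, d} : Finset V) := by simp [hbc, hbd]
  have h2 : ({b, c, d} : Finset V).powersetCard 2 = {{b, c}, {b, d}, {c, d}} := by
    rw [Finset.powersetCard_succ_insert h1, Finset.powersetCard_one]
    have : ({c, d} : Finset V).powersetCard (1 + 1) = {{c, d}} := by
      have h := Finset.powersetCard_self ({c, d} : Finset V)
      rwa [Finset.card_pair hcd] at h
    rw [this]
    ext e
    simp
    tauto
  have h3 : ({b, c} : Finset V) ∉ ({{b, d}, {c, d}} : Finset (Finset V)) := by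
    simp only [Finset.mem_insert, Finset.mem_singleton, not_or]
    exact ⟨fun h => by simpa [hbc.symm, hcd] using (Finset.ext_iff.1 h c),
      fun h => by simpa [hbc, hbd] using (Finset.ext_iff.1 h b)⟩
  have h4 : ({b, d} : Finset V) ≠ {c, d} :=
    fun h => by simpa [hbc, hbd] using (Finset.ext_iff.1 h b)
  rw [InVirtualSpace, erase_four hib hic hid, h2, Finset.sum_insert h3,
    Finset.sum_pair h4, Finset.sum_insert h1, Finset.sum_pair hcd, Finset.prod_pair hbc,
    Finset.prod_pair hbd, Finset.prod_pair hcd]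
  simp only [one_div_mul_one_div, add_assoc]

theorem solidAngle_eq_volume_conformalRegion {r : V → ℝ} (hr : ∀ j, 0 < r j) {p : V → E3}
    (hp : IsConformal r {i, b, c, d} p) (hQ : 0 < fourQ (r i) (r b) (r c) (r d)) :
    solidAngle p {i, b, c, d} i =
      3 * volume.real (Metric.ball 0 1 ∩ conformalRegion (r i) (r b) (r c) (r d)) := by
  have hi := hr i
  have hb := hr b
  have hc := hr c
  have hd := hr d
  refine solidAngle_eq_volume_coneRegion (erase_four hib hic hid) hbc hbd hcd
    (by positivity) (edgeY_pos hi hb hc) (Real.sqrt_pos.2 (by positivity)) ?_ ?_ ?_ ?_ ?_ ?_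
  · rw [inner_edge_self hp (by simp) (by simp) hib]
  · rw [inner_edge hp (by simp) (by simp) (by simp) hib hic hbc, edgeX,
      mul_div_cancel₀ _ (by positivity)]
  · rw [inner_edge hp (by simp) (by simp) (by simp) hib hid hbd, edgeX,
      mul_div_cancel₀ _ (by positivity)]
  · rw [inner_edge_self hp (by simp) (by simp) hic, edgeX_sq_add_edgeY_sq hi hb hc]
  · rw [inner_edge hp (by simp) (by simp) (by simp) hic hid hcd, edgeY_mul_edgeW hi hb hc]
    ring
  · rw [inner_edge_self hp (by simp) (by simp) hid, edge_normSq hi hb hc hd hQ.le]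

/-- By `fourQ_eq`, `Q ≤ 0` says that `1/r_i` differs from the sum of the other inverse radii by at
least the square root term of the gap condition. That condition thus reduces to a strict inequality
without roots. -/
theorem extendedSolidAngle_four {r : V → ℝ} (hr : ∀ j, 0 < r j) :
    extendedSolidAngle r {i, b, c, d} i =
      if 0 < fourQ (r i) (r b) (r c) (r d) then
        3 * volume.real (Metric.ball 0 1 ∩ conformalRegion (r i) (r b) (r c) (r d))
      else if 1 / r b + 1 / r c + 1 / r d < 1 / r i then 2 * Real.pi else 0 := by
  rw [extendedSolidAngle, Q_four hib hic hid hbc hbd hcd]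
  split_ifs with h1 h2 h3 h3
  · refine solidAngle_eq_volume_conformalRegion hib hic hid hbc hbd hcd hr ?_ h1
    refine isConformal_conformalTetrahedron ?_ (fun j _ => hr j) ?_
    · rw [Finset.card_insert_of_notMem (by simp [hib, hic, hid]),
        Finset.card_insert_of_notMem (by simp [hbc, hbd]), Finset.card_pair hcd]
    · rwa [Q_four hib hic hid hbc hbd hcd]
  · rfl
  · rw [inVirtualSpace_four hib hic hid hbc hbd hcd] at h2
    have hb := hr b
    have hc := hr c
    have hd := hr d
    have : 0 < √(1 / r b * (1 / r c) + 1 / r b * (1 / r d) + 1 / r c * (1 / r d)) :=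
      Real.sqrt_pos.2 (by positivity)
    linarith
  · rw [inVirtualSpace_four hib hic hid hbc hbd hcd] at h2
    rw [fourQ_eq] at h1
    set e := 1 / r b * (1 / r c) + 1 / r b * (1 / r d) + 1 / r c * (1 / r d)
    have h4 : √(4 * e) ≤ 1 / r i - (1 / r b + 1 / r c + 1 / r d) :=
      Real.sqrt_le_iff.2 ⟨by linarith, by linarith⟩
    rw [Real.sqrt_mul (by norm_num), show (4 : ℝ) = 2 ^ 2 by norm_num,
      Real.sqrt_sq (by norm_num)] at h4
    exact absurd (by linarith) h2
  · rfl

theorem continuousAt_extendedSolidAngle_four {r₀ : V → ℝ} (hr : ∀ j, 0 < r₀ j) [Finite V] :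
    ContinuousAt (fun r : V → ℝ => extendedSolidAngle r {i, b, c, d} i) r₀ := by
  have hi := hr i
  have hb := hr b
  have hc := hr c
  have hd := hr d
  have hpos : ∀ᶠ r : V → ℝ in 𝓝 r₀, ∀ j, 0 < r j := by
    rw [eventually_all]
    exact fun j => (continuous_apply j).continuousAt.eventually_const_lt (hr j)
  have heq := hpos.mono fun r => extendedSolidAngle_four hib hic hid hbc hbd hcd
  refine ContinuousAt.congr ?_ (EventuallyEq.symm heq)
  have cQ := continuousAt_fourQ hr i b c d
  have k := continuousAt_one_div hr
  have ci := k i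
  have cs : ContinuousAt (fun r : V → ℝ => 1 / r b + 1 / r c + 1 / r d) r₀ :=
    ((k b).add (k c)).add (k d)
  have hvol := tendsto_volume_conformalRegion (i := i) (b := b) (c := c) (d := d) hr
  unfold ContinuousAt
  -- Equality would leave only the positive product terms of `fourQ_eq`, so the two virtual regimes
  -- are never adjacent within `Q ≤ 0`.
  have hne : fourQ (r₀ i) (r₀ b) (r₀ c) (r₀ d) ≤ 0 →
      1 / r₀ b + 1 / r₀ c + 1 / r₀ d ≠ 1 / r₀ i := by
    intro h he
    rw [fourQ_eq, he, sub_self] at h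
    have : 0 < 1 / r₀ b * (1 / r₀ c) + 1 / r₀ b * (1 / r₀ d) + 1 / r₀ c * (1 / r₀ d) := by
      positivity
    linarith
  have htail : fourQ (r₀ i) (r₀ b) (r₀ c) (r₀ d) ≤ 0 → Tendsto (fun r : V → ℝ =>
      if 1 / r b + 1 / r c + 1 / r d < 1 / r i then 2 * Real.pi else 0) (𝓝 r₀)
      (𝓝 (if 1 / r₀ b + 1 / r₀ c + 1 / r₀ d < 1 / r₀ i then 2 * Real.pi else 0)) := by
    intro h
    refine Tendsto.congr' ?_ tendsto_const_nhds
    rcases lt_or_gt_of_ne (hne h) with h' | h'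
    · filter_upwards [cs.eventually_lt ci h'] with r e
      rw [if_pos e, if_pos h']
    · filter_upwards [ci.eventually_lt cs h'] with r e
      rw [if_neg e.not_gt, if_neg h'.not_gt]
  beta_reduce
  rcases lt_trichotomy (fourQ (r₀ i) (r₀ b) (r₀ c) (r₀ d)) 0 with h | h | h
  · rw [if_neg h.not_gt]
    refine (htail h.le).congr' ?_
    filter_upwards [cQ.eventually_lt_const h] with r e
    rw [if_neg e.not_gt]
  · rw [if_neg h.not_gt]
    -- At `Q = 0` real and virtual packings accumulate, so both branches must have the same limit;
    -- the flat cone volumes supply this.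
    refine Tendsto.if' ?_ (htail h.le)
    convert hvol h.ge using 2
    split_ifs with h'
    · exact (volume_conformalRegion_of_lt hi hb hc hd h h').symm
    · exact (volume_conformalRegion_of_gt hi hb hc hd h
        (lt_of_le_of_ne (not_lt.1 h') (hne h.le).symm)).symm
  · rw [if_pos h]
    refine (hvol h.le).congr' ?_
    filter_upwards [cQ.eventually_const_lt h] with r e1
    rw [if_pos e1]

end Angle

theorem continuousAt_extendedSolidAngle {V : Type*} [Finite V] [DecidableEq V] {σ : Finset V}
    {i : V} (hσ : σ.card = 4) (hi : i ∈ σ) {r₀ : V → ℝ} (hr : ∀ j, 0 < r₀ j) :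
    ContinuousAt (fun r : V → ℝ => extendedSolidAngle r σ i) r₀ := by
  have h3 : (σ.erase i).card = 3 := by rw [Finset.card_erase_of_mem hi, hσ]
  obtain ⟨b, c, d, hbc, hbd, hcd, h⟩ := Finset.card_eq_three.1 h3
  have hne : ∀ j ∈ σ.erase i, i ≠ j := fun j hj => (Finset.ne_of_mem_erase hj).symm
  have h4 : σ = {i, b, c, d} := by rw [← Finset.insert_erase hi, h]
  rw [h] at hne
  rw [h4]
  exact continuousAt_extendedSolidAngle_four (hne b (by simp)) (hne c (by simp))
    (hne d (by simp)) hbc hbd hcd hr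

/-! ### Continuity of the curvature and the limit of the flow -/

section Packing

variable {V : Type*} [Fintype V] [DecidableEq V] {M : Type*} [TopologicalSpace M]

omit [DecidableEq V] in
theorem card_of_mem_tetrahedra {T : Triangulation V M} {σ : Finset V} (h : σ ∈ T.tetrahedra) :
    σ.card = 4 := by
  classical
  exact (Finset.mem_filter.1 h).2.2

theorem continuousAt_extendedCurvature (T : Triangulation V M) {r₀ : V → ℝ}
    (hr : ∀ j, 0 < r₀ j) (i : V) :
    ContinuousAt (fun r : V → ℝ => extendedCurvature T r i) r₀ := by
  unfold extendedCurvature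
  refine continuousAt_const.sub (tendsto_finsetSum _ fun σ hσ => ?_)
  obtain ⟨hT, hiσ⟩ := Finset.mem_filter.1 hσ
  exact continuousAt_extendedSolidAngle (card_of_mem_tetrahedra hT) hiσ hr

theorem continuousAt_extendedCRG [Nonempty V] (T : Triangulation V M) {r₀ : V → ℝ}
    (hr : ∀ j, 0 < r₀ j) : ContinuousAt (fun r : V → ℝ => extendedCRG T r) r₀ := by
  unfold extendedCRG
  refine ContinuousAt.div (tendsto_finsetSum _ fun i _ => ?_) (by fun_prop)
    (Finset.sum_pos (fun i _ => hr i) Finset.univ_nonempty).ne'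
  exact (continuousAt_extendedCurvature T hr i).mul (continuous_apply i).continuousAt

end Packing

/-- If a function and its derivative both converge at infinity, then the derivative tends to `0`. -/
theorem eq_zero_of_tendsto_of_tendsto_deriv {f f' : ℝ → ℝ} {a b : ℝ}
    (hf : ∀ t, 0 < t → HasDerivAt f (f' t) t) (ha : Tendsto f atTop (𝓝 a))
    (hb : Tendsto f' atTop (𝓝 b)) : b = 0 := by
  have h : ∀ t : ℝ, ∃ ξ, t ≤ ξ ∧ (0 < t → f' ξ = f (t + 1) - f t) := by
    intro t
    by_cases ht : 0 < t
    · obtain ⟨ξ, hξ, h⟩ := exists_hasDerivAt_eq_slope f f' (lt_add_one t)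
        (fun s hs => (hf s (ht.trans_le hs.1)).continuousAt.continuousWithinAt)
        (fun s hs => hf s (ht.trans hs.1))
      exact ⟨ξ, hξ.1.le, fun _ => by simpa using h⟩
    · exact ⟨t, le_rfl, fun h => absurd h ht⟩
  choose ξ hξ h using h
  have h1 : Tendsto (fun t => f' (ξ t)) atTop (𝓝 b) :=
    hb.comp (tendsto_atTop_mono hξ tendsto_id)
  have h2 : Tendsto (fun t => f (t + 1) - f t) atTop (𝓝 (a - a)) :=
    (ha.comp (tendsto_atTop_add_const_right _ _ tendsto_id)).sub ha
  rw [sub_self] at h2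
  refine tendsto_nhds_unique h1 (h2.congr' ?_)
  filter_upwards [eventually_gt_atTop 0] with t ht
  exact (h t ht).symm

end BallPacking

open BallPacking in
theorem mainTheorem11 {M : Type*} [TopologicalSpace M] [T2Space M] [CompactSpace M]
    [ChartedSpace (EuclideanSpace ℝ (Fin 3)) M] {V : Type*} [Fintype V] [DecidableEq V]
    (T : BallPacking.Triangulation V M) (r : ℝ → V → ℝ) (hr : BallPacking.IsExtendedFlow T r)
    (rInf : V → ℝ) (hpos : ∀ i, 0 < rInf i) (hlim : Tendsto r atTop (𝓝 rInf)) :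
    (BallPacking.IsRealPacking T rInf ∨ BallPacking.IsVirtualPacking T rInf) ∧
      BallPacking.HasConstantExtendedCurvature T rInf := by
  refine ⟨or_iff_not_imp_left.2 fun h => ⟨hpos, h⟩, extendedCRG T rInf, fun i => ?_⟩
  -- Needed for the denominator `∑ r_i` of `λ̃` to be positive.
  have : Nonempty V := ⟨i⟩
  have hlim' := tendsto_pi_nhds.1 hlim i
  have hK := (continuousAt_extendedCurvature T hpos i).tendsto.comp hlim
  have hlam := (continuousAt_extendedCRG T hpos).tendsto.comp hlim
  -- At `t > 0` the derivative within `Ici 0` is a two-sided one.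
  have h0 := eq_zero_of_tendsto_of_tendsto_deriv
    (fun t ht => (hr.2 t ht.le i).hasDerivAt (Ici_mem_nhds ht)) hlim' ((hlam.sub hK).mul hlim')
  exact (sub_eq_zero.1 ((mul_eq_zero.1 h0).resolve_right (hpos i).ne')).symm
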